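/- Let $n\ge 0$ be an integer, $p=(p_1,\dots,p_n)\in[0,1]^n$ and $D>0$. For $t=1,2,\dots$ and $i\in[n]$ let $X_{t,i}\sim\mathrm{Bern}(p_i)$ be independent over all $t$ and $i$. At each time $t$ a learner selects a set $S_t\subseteq[n]$, based on the past (and possibly on private randomization) and independent of $(X_{t,i})_{i\in[n]}$, and then observes $X_{t,i}$ for $i\in S_t$. Put $L_t(S)=\left(\sum_{i\in S}X_{t,i}-D\right)^2$ and $$\mathrm{Regret}(T)=\mathbb E\Big[\sum_{t=1}^T\big(L_t(S_t)-L_t(S_t^*)\big)\Big],\qquad S_t^*\in\operatorname*{arg\,min}_{S\subseteq[n]}\mathbb E[L_t(S)].$$ Let $T_i(t)$ be the number of times $\tau\le t$ with $i\in S_\tau$, and $\bar p_i(t)$ the average of $X_{\tau,i}$ over these times. The algorithm CUCB-Avg with parameter $\alpha$ works as follows. In the first $\lceil n/\lceil 2D\rceil\rceil$ time steps it selects each arm at least once (for instance $\lceil 2D\rceil$ new arms at each step until none is left). At each later time $t$ it computes $$U_i(t)=\min\Big(\bar p_i(t-1)+\sqrt{\tfrac{\alpha\log t}{2T_i(t-1)}},\,1\Big),$$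 ranks the arms so that $U_{\sigma(1)}(t)\ge\dots\ge U_{\sigma(n)}(t)$ (ties broken arbitrarily, possibly at random), takes the smallest $k\ge 0$ with $\sum_{j=1}^{k}\bar p_{\sigma(j)}(t-1)>D-\tfrac12$, or $k=n$ if there is none, and selects $S_t=\{\sigma(1),\dots,\sigma(k)\}$. Theorem. There is a constant $\epsilon_0>0$, depending only on $p$ and $D$, such that for every $\alpha>2$ the regret of CUCB-Avg satisfies, for all $T$ with $T\ge 1$, $$\mathrm{Regret}(T)\le M\left(\left\lceil\frac{n}{\lceil 2D\rceil}\right\rceil+\frac{2n}{\alpha-2}\right)+\frac{\alpha M n\log T}{2\epsilon_0^2},\qquad M=\max\big(D^2,(n-D)^2\big).$$ In particular, $\mathrm{Regret}(T)=O(\log T)$ as $T\to\infty$. -/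

import Mathlib

open MeasureTheory ProbabilityTheory

noncomputable section

namespace DemandResponse

variable {Ω : Type*} {n : ℕ}

/-! Time steps are `t = 1, 2, …` (the value at `t = 0` is never used), customers (arms) are the
elements of `Fin n`, `X t i ω` is the load reduction of customer `i` at time `t`, and `S t ω` is
the set of customers selected at time `t`. -/

/-- The responses: at each time `t ≥ 1` customer `i` reduces one unit with probability `p i` and
zero units otherwise, independently across time and across customers. -/
structure IsResponseModel [MeasurableSpace Ω] (μ : Measure Ω) (p : Fin n → unitInterval)
    (X : ℕ → Fin n → Ω → ℝ) : Prop where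
  measurable : ∀ t, 1 ≤ t → ∀ i, Measurable (X t i)
  hasLaw : ∀ t, 1 ≤ t → ∀ i, HasLaw (X t i) (bernoulliMeasure (1 : ℝ) 0 (p i)) μ
  indep : iIndepFun (fun q : {t : ℕ // 1 ≤ t} × Fin n => X q.1.1 q.2) μ

/-- The selections are non-anticipating: for some filtration `ℱ` (the information, including any
private randomization, after each time step), the responses up to time `t` are known at time `t`,
the selection at time `t + 1` is determined by the information at time `t`, and the responses at
time `t + 1` are independent of that information. -/
def IsNonanticipating [mΩ : MeasurableSpace Ω] (μ : Measure Ω) (X : ℕ → Fin n → Ω → ℝ)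
    (S : ℕ → Ω → Finset (Fin n)) : Prop :=
  ∃ ℱ : Filtration ℕ mΩ,
    (∀ t, 1 ≤ t → ∀ i, Measurable[ℱ t] (X t i)) ∧
    (∀ t i, MeasurableSet[ℱ t] {ω | i ∈ S (t + 1) ω}) ∧
    (∀ t, Indep (ℱ t) (MeasurableSpace.comap (fun ω i => X (t + 1) i ω) inferInstance) μ)

/-- The cost `L_t(A)`: the squared deviation of the total reduction from the target. -/
def loss (X : ℕ → Fin n → Ω → ℝ) (D : ℝ) (t : ℕ) (A : Finset (Fin n)) (ω : Ω) : ℝ :=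
  (∑ i ∈ A, X t i ω - D) ^ 2

/-- `A` minimizes the expected cost `E[L_t(A)]` among all subsets of customers. -/
def IsOptimal [MeasurableSpace Ω] (μ : Measure Ω) (X : ℕ → Fin n → Ω → ℝ) (D : ℝ) (t : ℕ)
    (A : Finset (Fin n)) : Prop :=
  ∀ B : Finset (Fin n), ∫ ω, loss X D t A ω ∂μ ≤ ∫ ω, loss X D t B ω ∂μ

/-- `∑_{t=1}^T R_t(S_t)`, where `R_t(S_t) = L_t(S_t) - L_t(S*_t)`. -/
def cumulativeRegret (X : ℕ → Fin n → Ω → ℝ) (S : ℕ → Ω → Finset (Fin n)) (D : ℝ)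
    (Sstar : ℕ → Finset (Fin n)) (T : ℕ) (ω : Ω) : ℝ :=
  ∑ t ∈ Finset.Icc 1 T, (loss X D t (S t ω) ω - loss X D t (Sstar t) ω)

/-- `Regret(T)`, the expectation of `∑_{t=1}^T R_t(S_t)`. -/
def regret [MeasurableSpace Ω] (μ : Measure Ω) (X : ℕ → Fin n → Ω → ℝ)
    (S : ℕ → Ω → Finset (Fin n)) (D : ℝ) (Sstar : ℕ → Finset (Fin n)) (T : ℕ) : ℝ :=
  ∫ ω, cumulativeRegret X S D Sstar T ω ∂μ

/-- `T_i(t)`, the number of times that arm `i` is selected up to and including time `t`. -/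
def pullCount (S : ℕ → Ω → Finset (Fin n)) (t : ℕ) (i : Fin n) (ω : Ω) : ℕ :=
  ((Finset.Icc 1 t).filter fun τ => i ∈ S τ ω).card

/-- The sample average of arm `i` over the times up to and including `t` at which it is
selected. -/
def sampleAvg (X : ℕ → Fin n → Ω → ℝ) (S : ℕ → Ω → Finset (Fin n)) (t : ℕ) (i : Fin n)
    (ω : Ω) : ℝ :=
  (∑ τ ∈ (Finset.Icc 1 t).filter fun τ => i ∈ S τ ω, X τ i ω) / pullCount S t i ω

/-- The upper confidence bound `U_i(t)`. -/
def ucb (X : ℕ → Fin n → Ω → ℝ) (S : ℕ → Ω → Finset (Fin n)) (α : ℝ) (t : ℕ) (i : Fin n)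
    (ω : Ω) : ℝ :=
  min (sampleAvg X S (t - 1) i ω + √(α * Real.log t / (2 * pullCount S (t - 1) i ω))) 1

/-- For a ranking `σ` of the arms (`σ 0` is the first) and estimates `v`: the smallest `k ≥ 0` such
that the first `k` ranked arms have `∑ v > D - 1/2`, or `n` if there is none. -/
def cutoff (v : Fin n → ℝ) (σ : Equiv.Perm (Fin n)) (D : ℝ) : ℕ :=
  sInf {k : ℕ | D - 1 / 2 < ∑ j : Fin n with j.val < k, v (σ j) ∨ k = n}

/-- The first `k` arms in the ranking `σ`. -/
def topArms (σ : Equiv.Perm (Fin n)) (k : ℕ) : Finset (Fin n) :=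
  (Finset.univ.filter fun j : Fin n => j.val < k).image σ

/-- The length `⌈n / ⌈2D⌉⌉` of the initialization phase. -/
def initLength (n : ℕ) (D : ℝ) : ℕ := ⌈(n : ℝ) / (⌈2 * D⌉₊ : ℝ)⌉₊

/-- The selections follow CUCB-Avg with parameter `α` and target `D`. In the initialization phase
each arm is selected at least once; any method to do so is allowed, for instance `⌈2D⌉` new arms at
a time until none is left. Afterwards the arms are ranked by their upper confidence bounds (with
an arbitrary, possibly random, order among ties), and the number of arms to select is determined by
the sample averages. -/
structure IsCUCBAvg (α D : ℝ) (X : ℕ → Fin n → Ω → ℝ) (S : ℕ → Ω → Finset (Fin n)) : Prop where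
  init : ∀ ω i, ∃ t ∈ Finset.Icc 1 (initLength n D), i ∈ S t ω
  select : ∀ ω t, initLength n D < t → ∃ σ : Equiv.Perm (Fin n),
    Antitone (fun j => ucb X S α t (σ j) ω) ∧
    S t ω = topArms σ (cutoff (fun i => sampleAvg X S (t - 1) i ω) σ D)

end DemandResponse

end

namespace DemandResponse

/-! The mean cost of a fixed set is its squared bias plus its variance. Adding an arm changes it by
`2 * p i` times the excess of the previous total mean over `D - 1/2`, so a set of best arms that
just reaches this threshold is optimal (`expectedLoss_le_of_threshold`). Since there are finitely
many arms and sets, errors up to some `ε` on the selected arms, together with optimistic indices,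
still produce such a set (`expectedLoss_topArms_le`, `exists_accuracy`).

Hence, after initialization, a step costs something only if a confidence interval fails or a
selected arm has been pulled at most `α log T / (2 ε²)` times. The second cause occurs at most that
often per arm. The first has probability at most `2 t ^ (1 - α)` per arm and step, which is summable
for `α > 2`; this rests on an exponential supermartingale that tolerates adaptive sampling
(`lintegral_exp_tiltedSum_le_one`). Each such step costs at most `M` in mean. -/

/-! ### Optimal sets for known means. -/

/-- The expected cost of selecting `A` when arm `i` has mean response `p i`. -/
noncomputable def expectedLoss {n : ℕ} (p : Fin n → ℝ) (D : ℝ) (A : Finset (Fin n)) : ℝ :=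
  (∑ i ∈ A, p i - D) ^ 2 + ∑ i ∈ A, p i * (1 - p i)

/-- The terms in `p j ^ 2` from the square and from the variance combine so that the sign of the
change depends only on the remaining total against `D - 1/2`. This is where the algorithm's
threshold comes from. -/
theorem expectedLoss_erase {n : ℕ} (p : Fin n → ℝ) (D : ℝ) {B : Finset (Fin n)} {j : Fin n}
    (hj : j ∈ B) :
    expectedLoss p D (B.erase j) =
      expectedLoss p D B - 2 * p j * (∑ i ∈ B, p i - p j - (D - 1 / 2)) := by
  have h₁ := Finset.add_sum_erase B p hj
  have h₂ := Finset.add_sum_erase B (fun i => p i * (1 - p i)) hj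
  rw [expectedLoss, expectedLoss, ← h₁, ← h₂]
  ring

theorem expectedLoss_insert {n : ℕ} (p : Fin n → ℝ) (D : ℝ) {B : Finset (Fin n)} {i : Fin n}
    (hi : i ∉ B) :
    expectedLoss p D (insert i B) =
      expectedLoss p D B + 2 * p i * (∑ k ∈ B, p k - (D - 1 / 2)) := by
  rw [expectedLoss, expectedLoss, Finset.sum_insert hi, Finset.sum_insert hi]
  ring

/-- A set of best arms whose total mean response just reaches `D - 1/2` minimizes the expected
cost. -/
theorem expectedLoss_le_of_threshold {n : ℕ} (p : Fin n → ℝ) (hp : ∀ i, 0 ≤ p i) (D : ℝ)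
    (A : Finset (Fin n)) (htop : ∀ i ∈ A, ∀ j ∉ A, p j ≤ p i)
    (hge : A = Finset.univ ∨ D - 1 / 2 ≤ ∑ i ∈ A, p i)
    (hle : ∀ i ∈ A, ∑ k ∈ A, p k - p i ≤ D - 1 / 2) (B : Finset (Fin n)) :
    expectedLoss p D A ≤ expectedLoss p D B := by
  -- Each case moves `B` closer to `A` without raising the cost: insert a missing arm, drop a
  -- superfluous one, or swap.
  induction h : (B \ A).card + (A \ B).card using Nat.strong_induction_on generalizing B with
  | _ m ih =>
  by_cases hBA : B ⊆ A
  · by_cases hAB : A ⊆ B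
    · rw [Finset.Subset.antisymm hBA hAB]
    · obtain ⟨i, hiA, hiB⟩ := Finset.not_subset.1 hAB
      have hlt : (A \ insert i B).card < (A \ B).card := Finset.card_lt_card <| by
        refine Finset.ssubset_iff_subset_ne.2 ⟨by grind, fun h => ?_⟩
        have : i ∈ A \ insert i B := h ▸ by simp [hiA, hiB]
        simp at this
      have h0 : insert i B \ A = B \ A := by grind
      refine (ih _ (by rw [← h, h0]; omega) (insert i B) rfl).trans ?_
      rw [expectedLoss_insert p D hiB]
      have h1 : ∑ k ∈ B, p k ≤ ∑ k ∈ A.erase i, p k :=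
        Finset.sum_le_sum_of_subset_of_nonneg (by grind) fun k _ _ => hp k
      have h2 := Finset.add_sum_erase A p hiA
      have h3 := hle i hiA
      have h4 : ∑ k ∈ B, p k - (D - 1 / 2) ≤ 0 := by linarith
      nlinarith [hp i, mul_nonneg_of_nonpos_of_nonpos (neg_nonpos.2 (hp i)) h4]
  · obtain ⟨j, hjB, hjA⟩ := Finset.not_subset.1 hBA
    have hge' : D - 1 / 2 ≤ ∑ i ∈ A, p i := hge.resolve_left fun h => hjA (by simp [h])
    have hlt : (B.erase j \ A).card < (B \ A).card := Finset.card_lt_card <| by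
      refine Finset.ssubset_iff_subset_ne.2 ⟨by grind, fun h => ?_⟩
      have : j ∈ B.erase j \ A := h ▸ by simp [hjA, hjB]
      simp at this
    have hs := Finset.add_sum_erase B p hjB
    by_cases hb : D - 1 / 2 ≤ ∑ i ∈ B, p i - p j
    · have h0 : A \ B.erase j = A \ B := by grind
      refine (ih _ (by rw [← h, h0]; omega) (B.erase j) rfl).trans ?_
      rw [expectedLoss_erase p D hjB]
      nlinarith [hp j, mul_nonneg (hp j) (sub_nonneg.2 hb)]
    -- Dropping `j` would fall below the threshold, so `A` must contain an arm `i` outside `B`.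
    -- Swapping `j` for `i` changes the cost by `2 (p i - p j)` times a negative deficit.
    · have hAB : ¬ A ⊆ B := fun hAB => hb <| by
        have : ∑ k ∈ A, p k ≤ ∑ k ∈ B.erase j, p k :=
          Finset.sum_le_sum_of_subset_of_nonneg (by grind) fun k _ _ => hp k
        linarith
      obtain ⟨i, hiA, hiB⟩ := Finset.not_subset.1 hAB
      have hiB' : i ∉ B.erase j := fun h => hiB (Finset.mem_of_mem_erase h)
      have h0 : insert i (B.erase j) \ A = B.erase j \ A := by grind
      have h0' : (A \ insert i (B.erase j)).card ≤ (A \ B).card :=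
        Finset.card_le_card (by grind)
      refine (ih _ (by rw [← h, h0]; omega) (insert i (B.erase j)) rfl).trans ?_
      rw [expectedLoss_insert p D hiB', expectedLoss_erase p D hjB]
      have h5 : ∑ k ∈ B.erase j, p k = ∑ k ∈ B, p k - p j := by linarith
      rw [h5]
      nlinarith [mul_nonneg (sub_nonneg.2 (htop i hiA j hjA)) (sub_nonneg.2 (not_le.1 hb).le)]

/-! ### Selection from estimated means. -/

theorem cutoff_spec {n : ℕ} (v : Fin n → ℝ) (σ : Equiv.Perm (Fin n)) (D : ℝ) :
    D - 1 / 2 < ∑ j : Fin n with j.val < cutoff v σ D, v (σ j) ∨ cutoff v σ D = n :=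
  Nat.sInf_mem (s := {k : ℕ | D - 1 / 2 < ∑ j : Fin n with j.val < k, v (σ j) ∨ k = n})
    ⟨n, Or.inr rfl⟩

theorem cutoff_le {n : ℕ} (v : Fin n → ℝ) (σ : Equiv.Perm (Fin n)) (D : ℝ) :
    cutoff v σ D ≤ n :=
  Nat.sInf_le (Or.inr rfl)

theorem sum_le_of_lt_cutoff {n : ℕ} (v : Fin n → ℝ) (σ : Equiv.Perm (Fin n)) (D : ℝ) {k : ℕ}
    (hk : k < cutoff v σ D) : ∑ j : Fin n with j.val < k, v (σ j) ≤ D - 1 / 2 := by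
  have := Nat.notMem_of_lt_sInf hk
  simp only [Set.mem_ofPred_eq, not_or, not_lt] at this
  exact this.1

theorem sum_topArms {n : ℕ} (v : Fin n → ℝ) (σ : Equiv.Perm (Fin n)) (k : ℕ) :
    ∑ i ∈ topArms σ k, v i = ∑ j : Fin n with j.val < k, v (σ j) :=
  Finset.sum_image fun _ _ _ _ h => σ.injective h

theorem mem_topArms {n : ℕ} {σ : Equiv.Perm (Fin n)} {k : ℕ} {j : Fin n} :
    σ j ∈ topArms σ k ↔ j.val < k := by
  simp [topArms]

/-- Selecting with sufficiently accurate estimates and optimistic indices is optimal. -/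
theorem expectedLoss_topArms_le {n : ℕ} (p : Fin n → ℝ) (hp₀ : ∀ i, 0 ≤ p i)
    (hp₁ : ∀ i, p i ≤ 1) (D ε : ℝ) (hε : 0 < ε)
    (hgap : ∀ i j, p i < p j → p i + 2 * ε < p j)
    (hlow : ∀ A : Finset (Fin n), ∑ i ∈ A, p i < D - 1 / 2 → ∑ i ∈ A, p i + n * ε < D - 1 / 2)
    (hhigh : ∀ A : Finset (Fin n), D - 1 / 2 < ∑ i ∈ A, p i → D - 1 / 2 < ∑ i ∈ A, p i - n * ε)
    (v r : Fin n → ℝ) (hv : ∀ i, |v i - p i| ≤ r i) (σ : Equiv.Perm (Fin n))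
    (hσ : Antitone fun j => min (v (σ j) + r (σ j)) 1)
    (hr : ∀ i ∈ topArms σ (cutoff v σ D), r i ≤ ε) (B : Finset (Fin n)) :
    expectedLoss p D (topArms σ (cutoff v σ D)) ≤ expectedLoss p D B := by
  have hU : ∀ i, p i ≤ min (v i + r i) 1 := fun i =>
    le_min (by linarith [(abs_le.1 (hv i)).1]) (hp₁ i)
  -- A misordering would give `p (σ k) ≤ U (σ k) ≤ U (σ j) ≤ p (σ j) + 2 * ε`, against the gap. Only
  -- the radius of the selected arm `σ j` has to be small.
  have hord : ∀ j k : Fin n, j ≤ k → j.val < cutoff v σ D → p (σ k) ≤ p (σ j) := by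
    intro j k hjk hj
    by_contra! hlt
    have h1 := (hU (σ k)).trans ((hσ hjk).trans (min_le_left _ _))
    have h2 := hr (σ j) (mem_topArms.2 hj)
    linarith [hgap _ _ hlt, (abs_le.1 (hv (σ j))).2]
  have hsum : ∀ C ⊆ topArms σ (cutoff v σ D), |∑ i ∈ C, v i - ∑ i ∈ C, p i| ≤ n * ε := by
    intro C hC
    rw [← Finset.sum_sub_distrib]
    refine (Finset.abs_sum_le_sum_abs _ _).trans ?_
    refine (Finset.sum_le_card_nsmul _ _ ε fun i hi => (hv i).trans (hr i (hC hi))).trans ?_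
    rw [nsmul_eq_mul]
    have : C.card ≤ n := by simpa using C.card_le_univ
    gcongr
  apply expectedLoss_le_of_threshold p hp₀
  · intro i hi j hj
    obtain ⟨i, rfl⟩ := σ.surjective i
    obtain ⟨j, rfl⟩ := σ.surjective j
    rw [mem_topArms] at hi hj
    exact hord i j (Fin.le_def.2 (by omega)) hi
  · rcases cutoff_spec v σ D with h | h
    · right
      rw [← sum_topArms] at h
      by_contra! hlt
      linarith [hlow _ hlt, (abs_le.1 (hsum _ subset_rfl)).2]
    · left
      ext i
      obtain ⟨i, rfl⟩ := σ.surjective i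
      simp [mem_topArms, h]
  · intro i hi
    obtain ⟨i, rfl⟩ := σ.surjective i
    rw [mem_topArms] at hi
    have hle := cutoff_le v σ D
    -- The last selected arm has the least mean, so its removal is the critical case. Minimality of
    -- the cutoff bounds the estimated sum without it, and `hhigh` transfers this to the means.
    obtain ⟨l, hl⟩ : ∃ l : Fin n, l.val + 1 = cutoff v σ D :=
      ⟨⟨cutoff v σ D - 1, by omega⟩, by simp only; omega⟩
    have hpl : p (σ l) ≤ p (σ i) := hord i l (Fin.le_def.2 (by omega)) hi
    have hC : (topArms σ (cutoff v σ D)).erase (σ l) = topArms σ l.val := by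
      ext k
      obtain ⟨k, rfl⟩ := σ.surjective k
      simp only [Finset.mem_erase, mem_topArms, ne_eq, EmbeddingLike.apply_eq_iff_eq, Fin.ext_iff]
      omega
    have h1 := sum_le_of_lt_cutoff v σ D (k := l.val) (by omega)
    rw [← sum_topArms, ← hC] at h1
    have h2 := Finset.add_sum_erase (topArms σ (cutoff v σ D)) p (a := σ l)
      (mem_topArms.2 (by omega))
    have h3 := (abs_le.1 (hsum _ (Finset.erase_subset (σ l) _))).1
    by_contra! hlt
    have h4 := hhigh ((topArms σ (cutoff v σ D)).erase (σ l)) (by linarith)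
    linarith

theorem exists_pos_le_of_pos {ι : Type*} [Finite ι] (f : ι → ℝ) :
    ∃ ε > 0, ∀ i, 0 < f i → ε < f i := by
  have h : ∀ᶠ ε in nhdsWithin (0 : ℝ) (Set.Ioi 0), ∀ i, 0 < f i → ε < f i := by
    rw [Filter.eventually_all]
    intro i
    by_cases hi : 0 < f i
    · filter_upwards [Ioo_mem_nhdsGT hi] with ε hε _ using hε.2
    · exact Filter.Eventually.of_forall fun ε h => absurd h hi
  obtain ⟨ε, h1, h2⟩ := (h.and self_mem_nhdsWithin).exists
  exact ⟨ε, h2, h1⟩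

/-- The accuracy of the estimates needed for an optimal selection. -/
theorem exists_accuracy {n : ℕ} (p : Fin n → ℝ) (D : ℝ) :
    ∃ ε : ℝ, 0 < ε ∧ (∀ i j, p i < p j → p i + 2 * ε < p j) ∧
      (∀ A : Finset (Fin n), ∑ i ∈ A, p i < D - 1 / 2 → ∑ i ∈ A, p i + n * ε < D - 1 / 2) ∧
      (∀ A : Finset (Fin n), D - 1 / 2 < ∑ i ∈ A, p i → D - 1 / 2 < ∑ i ∈ A, p i - n * ε) := by
  obtain ⟨ε₁, h₁, hg⟩ := exists_pos_le_of_pos fun q : Fin n × Fin n => p q.2 - p q.1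
  obtain ⟨ε₂, h₂, hl⟩ := exists_pos_le_of_pos fun A : Finset (Fin n) =>
    D - 1 / 2 - ∑ i ∈ A, p i
  obtain ⟨ε₃, h₃, hh⟩ := exists_pos_le_of_pos fun A : Finset (Fin n) =>
    ∑ i ∈ A, p i - (D - 1 / 2)
  have hn : (0 : ℝ) < n + 2 := by positivity
  set δ := min ε₁ (min ε₂ ε₃) with hδ
  have hδ₀ : 0 < δ := lt_min h₁ (lt_min h₂ h₃)
  have hε : 0 < δ / (n + 2) := by positivity
  -- Division by `n + 2` keeps both `n * ε` and `2 * ε` at most `δ`, also when `n = 0`.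
  have hmul : n * (δ / (n + 2)) + 2 * (δ / (n + 2)) = δ := by field_simp
  have hn0 : 0 ≤ n * (δ / (n + 2)) := by positivity
  have d1 : δ ≤ ε₁ := min_le_left _ _
  have d2 : δ ≤ ε₂ := (min_le_right _ _).trans (min_le_left _ _)
  have d3 : δ ≤ ε₃ := (min_le_right _ _).trans (min_le_right _ _)
  refine ⟨δ / (n + 2), hε, fun i j hij => ?_, fun A hA => ?_, fun A hA => ?_⟩
  · linarith [hg (i, j) (sub_pos.2 hij)]
  · linarith [hl A (sub_pos.2 hA)]
  · linarith [hh A (sub_pos.2 hA)]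

/-! ### Moments of the responses and mean cost of adaptive selections. -/

section Model

variable {Ω : Type*} {n : ℕ}

theorem loss_nonneg (X : ℕ → Fin n → Ω → ℝ) (D : ℝ) (t : ℕ) (A : Finset (Fin n)) (ω : Ω) :
    0 ≤ loss X D t A ω := sq_nonneg _

/-- The exponent of Hoeffding's exponential supermartingale for arm `i`. -/
noncomputable def tiltedSum (X : ℕ → Fin n → Ω → ℝ) (S : ℕ → Ω → Finset (Fin n)) (q : ℝ)
    (i : Fin n) (c : ℝ) (t : ℕ) (ω : Ω) : ℝ :=
  ∑ τ ∈ Finset.Icc 1 t, if i ∈ S τ ω then c * (X τ i ω - q) - c ^ 2 / 8 else 0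

/-- Turns a deviation of the sample average into a lower bound on the supermartingale's exponent. -/
theorem tiltedSum_eq (X : ℕ → Fin n → Ω → ℝ) (S : ℕ → Ω → Finset (Fin n)) (q : ℝ)
    (i : Fin n) (c : ℝ) (t : ℕ) (ω : Ω) (hT : 1 ≤ pullCount S t i ω) :
    tiltedSum X S q i c t ω =
      pullCount S t i ω * (c * (sampleAvg X S t i ω - q) - c ^ 2 / 8) := by
  have hT' : (pullCount S t i ω : ℝ) ≠ 0 := by positivity
  rw [tiltedSum, ← Finset.sum_filter, Finset.sum_sub_distrib, ← Finset.mul_sum,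
    Finset.sum_sub_distrib, Finset.sum_const, Finset.sum_const, sampleAvg]
  simp only [nsmul_eq_mul]
  change c * (_ - (pullCount S t i ω : ℝ) * q) - (pullCount S t i ω : ℝ) * (c ^ 2 / 8) = _
  field_simp

variable [mΩ : MeasurableSpace Ω] {μ : Measure Ω}
  {p : Fin n → unitInterval} {X : ℕ → Fin n → Ω → ℝ} {S : ℕ → Ω → Finset (Fin n)}

theorem IsResponseModel.ae_eq_zero_or_one (hX : IsResponseModel μ p X) {t : ℕ} (ht : 1 ≤ t)
    (i : Fin n) : ∀ᵐ ω ∂μ, X t i ω = 0 ∨ X t i ω = 1 := by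
  have hs : MeasurableSet {x : ℝ | x = 0 ∨ x = 1} :=
    (measurableSet_singleton (0 : ℝ)).union (measurableSet_singleton (1 : ℝ))
  rw [(hX.hasLaw t ht i).ae_iff (p := fun x : ℝ => x = 0 ∨ x = 1) (measurableSet_setOfPred.1 hs),
    ae_iff]
  exact bernoulliMeasure_apply_of_notMem_of_notMem _ hs.compl (by simp) (by simp)

theorem IsResponseModel.ae_mem_Icc [IsProbabilityMeasure μ]
    (hX : IsResponseModel μ p X) {t : ℕ} (ht : 1 ≤ t)
    (i : Fin n) : ∀ᵐ ω ∂μ, X t i ω ∈ Set.Icc (0 : ℝ) 1 := by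
  filter_upwards [hX.ae_eq_zero_or_one ht i] with ω h
  rcases h with h | h <;> simp [h]

theorem IsResponseModel.memLp [IsProbabilityMeasure μ]
    (hX : IsResponseModel μ p X) {t : ℕ} (ht : 1 ≤ t)
    (i : Fin n) : MemLp (X t i) 2 μ :=
  MemLp.of_bound (hX.measurable t ht i).aestronglyMeasurable 1 <| by
    filter_upwards [hX.ae_mem_Icc ht i] with ω h
    rw [Real.norm_eq_abs, abs_of_nonneg h.1]
    exact h.2

theorem IsResponseModel.integral_eq (hX : IsResponseModel μ p X) {t : ℕ} (ht : 1 ≤ t)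
    (i : Fin n) : ∫ ω, X t i ω ∂μ = p i := by
  rw [(hX.hasLaw t ht i).integral_eq, integral_bernoulliMeasure]
  simp

theorem IsResponseModel.variance_eq [IsProbabilityMeasure μ]
    (hX : IsResponseModel μ p X) {t : ℕ} (ht : 1 ≤ t)
    (i : Fin n) : variance (X t i) μ = p i * (1 - p i) := by
  rw [variance_eq_sub (hX.memLp ht i), hX.integral_eq ht i]
  have : ∫ ω, (X t i ^ 2) ω ∂μ = ∫ ω, X t i ω ∂μ := by
    apply integral_congr_ae
    filter_upwards [hX.ae_eq_zero_or_one ht i] with ω h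
    rcases h with h | h <;> simp [h]
  rw [this, hX.integral_eq ht i]
  ring

theorem IsResponseModel.integral_loss [IsProbabilityMeasure μ]
    (hX : IsResponseModel μ p X) {t : ℕ} (ht : 1 ≤ t) (D : ℝ)
    (A : Finset (Fin n)) :
    ∫ ω, loss X D t A ω ∂μ = expectedLoss (fun i => (p i : ℝ)) D A := by
  have hY : MemLp (fun ω => ∑ i ∈ A, X t i ω) 2 μ := memLp_finsetSum A fun i _ => hX.memLp ht i
  have hYD : MemLp (fun ω => ∑ i ∈ A, X t i ω - D) 2 μ := hY.sub (memLp_const D)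
  have hvar : variance (fun ω => ∑ i ∈ A, X t i ω) μ = ∑ i ∈ A, (p i : ℝ) * (1 - p i) := by
    have h := IndepFun.variance_sum (μ := μ) (X := fun i => X t i) (s := A)
      (fun i _ => hX.memLp ht i) fun i _ j _ hij =>
        hX.indep.indepFun (i := (⟨t, ht⟩, i)) (j := (⟨t, ht⟩, j)) (by simpa using hij)
    have h' : (∑ i ∈ A, X t i) = fun ω => ∑ i ∈ A, X t i ω := by ext; simp
    rw [← h', h]
    exact Finset.sum_congr rfl fun i _ => hX.variance_eq ht i
  have hmean : ∫ ω, (∑ i ∈ A, X t i ω - D) ∂μ = ∑ i ∈ A, (p i : ℝ) - D := by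
    rw [integral_sub (hY.integrable one_le_two) (integrable_const D),
      integral_finsetSum _ fun i _ => (hX.memLp ht i).integrable one_le_two]
    simp [hX.integral_eq ht]
  have h1 := variance_eq_sub hYD
  rw [variance_sub_const hY.aestronglyMeasurable, hvar, hmean] at h1
  have h2 : ∫ ω, loss X D t A ω ∂μ = ∫ ω, ((fun ω => ∑ i ∈ A, X t i ω - D) ^ 2) ω ∂μ := rfl
  rw [h2, expectedLoss]
  linarith

theorem loss_measurable (hX : IsResponseModel μ p X) {t : ℕ} (ht : 1 ≤ t) (D : ℝ)
    (A : Finset (Fin n)) : Measurable (loss X D t A) :=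
  ((Finset.measurable_fun_sum A fun i _ => hX.measurable t ht i).sub_const D).pow_const 2

/-- The largest possible cost. -/
theorem IsResponseModel.ae_loss_le [IsProbabilityMeasure μ]
    (hX : IsResponseModel μ p X) {t : ℕ} (ht : 1 ≤ t) (D : ℝ) :
    ∀ᵐ ω ∂μ, ∀ A, loss X D t A ω ≤ max (D ^ 2) ((n - D) ^ 2) := by
  have h : ∀ᵐ ω ∂μ, ∀ i, X t i ω ∈ Set.Icc (0 : ℝ) 1 := ae_all_iff.2 fun i => hX.ae_mem_Icc ht i
  filter_upwards [h] with ω h A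
  have h0 : 0 ≤ ∑ i ∈ A, X t i ω := Finset.sum_nonneg fun i _ => (h i).1
  have h1 : ∑ i ∈ A, X t i ω ≤ n := by
    refine (Finset.sum_le_card_nsmul A _ 1 fun i _ => (h i).2).trans ?_
    simpa using A.card_le_univ
  rw [loss, le_max_iff]
  by_cases hle : ∑ i ∈ A, X t i ω ≤ D
  · left; nlinarith
  · right; nlinarith

theorem IsResponseModel.integrable_loss [IsProbabilityMeasure μ]
    (hX : IsResponseModel μ p X) {t : ℕ} (ht : 1 ≤ t) (D : ℝ)
    (A : Finset (Fin n)) : Integrable (loss X D t A) μ :=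
  Integrable.of_bound (loss_measurable hX ht D A).aestronglyMeasurable
    (max (D ^ 2) ((n - D) ^ 2)) <| by
      filter_upwards [hX.ae_loss_le ht D] with ω h
      rw [Real.norm_eq_abs, abs_of_nonneg (loss_nonneg X D t A ω)]
      exact h A

theorem IsResponseModel.expectedLoss_le [IsProbabilityMeasure μ]
    (hX : IsResponseModel μ p X) (D : ℝ)
    (A : Finset (Fin n)) :
    expectedLoss (fun i => (p i : ℝ)) D A ≤ max (D ^ 2) ((n - D) ^ 2) := by
  rw [← hX.integral_loss le_rfl D A]
  have h := integral_mono_ae (hX.integrable_loss le_rfl D A)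
    (integrable_const (max (D ^ 2) ((n - D) ^ 2))) (by
      filter_upwards [hX.ae_loss_le le_rfl D] with ω h using h A)
  simpa using h

theorem expectedLoss_nonneg (p : Fin n → unitInterval) (D : ℝ) (A : Finset (Fin n)) :
    0 ≤ expectedLoss (fun i => (p i : ℝ)) D A :=
  add_nonneg (sq_nonneg _) <| Finset.sum_nonneg fun i _ =>
    mul_nonneg (p i).2.1 (sub_nonneg.2 (p i).2.2)

theorem measurable_selection {ℱ : Filtration ℕ mΩ}
    (hS : ∀ t i, MeasurableSet[ℱ t] {ω | i ∈ S (t + 1) ω}) (t : ℕ) :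
    Measurable[ℱ t] (S (t + 1)) :=
  (@measurable_finset_iff _ _ (ℱ t) _).2 fun i => (@measurableSet_setOfPred _ (ℱ t) _).1 (hS t i)

theorem IsNonanticipating.measurable (h : IsNonanticipating μ X S) {t : ℕ} (ht : 1 ≤ t) :
    Measurable (S t) := by
  obtain ⟨ℱ, -, hS, -⟩ := h
  obtain ⟨t, rfl⟩ := Nat.exists_eq_add_of_le' ht
  exact (measurable_selection hS t).mono (ℱ.le t) le_rfl

theorem integrable_comp_selection [IsProbabilityMeasure μ]
    {s : Ω → Finset (Fin n)} (hs : Measurable s)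
    (g : Finset (Fin n) → ℝ) : Integrable (fun ω => g (s ω)) μ := by
  refine Integrable.of_bound ((measurable_of_countable g).comp hs).aestronglyMeasurable
    (∑ A, |g A|) (.of_forall fun ω => ?_)
  exact Finset.single_le_sum (f := fun A => |g A|) (fun A _ => abs_nonneg _) (Finset.mem_univ (s ω))

/-- The cost of a non-anticipating selection and its conditional expectation have the same mean. -/
theorem integrable_loss_selection_and_integral_eq [IsProbabilityMeasure μ]
    (hX : IsResponseModel μ p X)
    (h : IsNonanticipating μ X S) {t : ℕ} (ht : 1 ≤ t) (D : ℝ) :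
    Integrable (fun ω => loss X D t (S t ω) ω) μ ∧
      ∫ ω, loss X D t (S t ω) ω ∂μ =
        ∫ ω, expectedLoss (fun i => (p i : ℝ)) D (S t ω) ∂μ := by
  have hmeas := h.measurable ht
  obtain ⟨ℱ, -, hS, hind⟩ := h
  obtain ⟨t, rfl⟩ := Nat.exists_eq_add_of_le' ht
  have hsel := measurable_selection hS t
  -- Splitting over the finitely many values of the selection leaves products of an indicator known
  -- at time `t` and a loss independent of it.
  let g : Finset (Fin n) → Ω → ℝ := fun A ω => if S (t + 1) ω = A then 1 else 0
  have hgm : ∀ A, Measurable[ℱ t] (g A) := fun A =>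
    Measurable.comp (measurable_of_countable fun B : Finset (Fin n) => if B = A then (1 : ℝ) else 0)
      hsel
  have hind' : ∀ A, IndepFun (g A) (loss X D (t + 1) A) μ := fun A => by
    refine indep_of_indep_of_le_left (indep_of_indep_of_le_right (hind t) ?_) (hgm A).comap_le
    have : Measurable fun x : Fin n → ℝ => (∑ i ∈ A, x i - D) ^ 2 := by fun_prop
    exact (Measurable.comp this (comap_measurable _)).comap_le
  have hgi : ∀ A, Integrable (g A) μ := fun A =>
    integrable_comp_selection hmeas fun B => if B = A then 1 else 0
  have hmul : ∀ A, Integrable (fun ω => g A ω * loss X D (t + 1) A ω) μ := fun A =>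
    (hind' A).integrable_mul (hgi A) (hX.integrable_loss ht D A)
  have hdec : ∀ c : Finset (Fin n) → Ω → ℝ,
      (fun ω => c (S (t + 1) ω) ω) = fun ω => ∑ A, g A ω * c A ω := by
    intro c
    ext ω
    simp [g]
  rw [hdec (loss X D (t + 1)), hdec fun A _ => expectedLoss (fun i => (p i : ℝ)) D A]
  refine ⟨integrable_finsetSum _ fun A _ => hmul A, ?_⟩
  rw [integral_finsetSum _ fun A _ => hmul A,
    integral_finsetSum _ fun A _ => (hgi A).mul_const _]
  refine Finset.sum_congr rfl fun A _ => ?_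
  rw [(hind' A).integral_fun_mul_eq_mul_integral (hgi A).aestronglyMeasurable
    (hX.integrable_loss ht D A).aestronglyMeasurable, hX.integral_loss ht, integral_mul_const]

/-! ### Concentration under adaptive sampling. -/

theorem measurable_tiltedSum {ℱ : Filtration ℕ mΩ}
    (hXm : ∀ t, 1 ≤ t → ∀ i, Measurable[ℱ t] (X t i))
    (hS : ∀ t i, MeasurableSet[ℱ t] {ω | i ∈ S (t + 1) ω}) (q : ℝ) (i : Fin n) (c : ℝ) (t : ℕ) :
    Measurable[ℱ t] (tiltedSum X S q i c t) := by
  refine @Finset.measurable_fun_sum _ _ _ _ _ _ (ℱ t) _ _ fun τ hτ => ?_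
  rw [Finset.mem_Icc] at hτ
  obtain ⟨τ, rfl⟩ := Nat.exists_eq_add_of_le' hτ.1
  refine Measurable.ite (m := ℱ t) (ℱ.mono (by omega : τ ≤ t) _ (hS τ i)) ?_ measurable_const
  exact ((((hXm _ hτ.1 i).mono (ℱ.mono hτ.2) le_rfl).sub_const q).const_mul c).sub_const _

/-- Hoeffding's lemma for a variable in an interval of length one, which accounts for `c ^ 2 / 8`.
-/
theorem IsResponseModel.lintegral_exp_le_one [IsProbabilityMeasure μ]
    (hX : IsResponseModel μ p X) {t : ℕ} (ht : 1 ≤ t)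
    (i : Fin n) (c : ℝ) :
    ∫⁻ ω, ENNReal.ofReal (Real.exp (c * (X t i ω - p i) - c ^ 2 / 8)) ∂μ ≤ 1 := by
  have hsub := hasSubgaussianMGF_of_mem_Icc (hX.measurable t ht i).aemeasurable
    (hX.ae_mem_Icc ht i)
  rw [hX.integral_eq ht i] at hsub
  have h1 := hsub.mgf_le c
  have h2 : (((‖(1 : ℝ) - 0‖₊ / 2) ^ 2 : NNReal) : ℝ) * c ^ 2 / 2 = c ^ 2 / 8 := by
    simp; ring
  rw [h2, mgf] at h1
  have h3 : ∀ ω, Real.exp (c * (X t i ω - p i) - c ^ 2 / 8) =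
      Real.exp (c * (X t i ω - p i)) * Real.exp (-(c ^ 2 / 8)) := fun ω => by
    rw [← Real.exp_add, sub_eq_add_neg]
  simp_rw [h3]
  rw [← ofReal_integral_eq_lintegral_ofReal ((hsub.integrable_exp_mul c).mul_const _)
    (.of_forall fun ω => by positivity), integral_mul_const, ENNReal.ofReal_le_one]
  calc _ ≤ Real.exp (c ^ 2 / 8) * Real.exp (-(c ^ 2 / 8)) := by gcongr
    _ = 1 := by rw [← Real.exp_add]; simp

/-- Whether arm `i` is pulled next is known at time `t`. If not, the exponential is unchanged; if
so, it gains an independent factor of mean at most one. -/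
theorem lintegral_exp_tiltedSum_le_one [IsProbabilityMeasure μ] (hX : IsResponseModel μ p X)
    (h : IsNonanticipating μ X S) (i : Fin n) (c : ℝ) (t : ℕ) :
    ∫⁻ ω, ENNReal.ofReal (Real.exp (tiltedSum X S (p i) i c t ω)) ∂μ ≤ 1 := by
  obtain ⟨ℱ, hXm, hS, hind⟩ := h
  induction t with
  | zero => simp [tiltedSum]
  | succ t ih =>
    set Z : Ω → ENNReal := fun ω => ENNReal.ofReal (Real.exp (tiltedSum X S (p i) i c t ω))
    set W : Ω → ENNReal := fun ω =>
      ENNReal.ofReal (Real.exp (c * (X (t + 1) i ω - p i) - c ^ 2 / 8))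
    have hZ : Measurable[ℱ t] Z :=
      (measurable_tiltedSum hXm hS (p i) i c t).exp.ennreal_ofReal
    have hE := hS t i
    set E := {ω | i ∈ S (t + 1) ω}
    have hle := ℱ.le t
    have hdec : ∀ ω, ENNReal.ofReal (Real.exp (tiltedSum X S (p i) i c (t + 1) ω)) =
        Eᶜ.indicator Z ω + E.indicator Z ω * W ω := by
      intro ω
      rw [tiltedSum, Finset.sum_Icc_succ_top (by omega)]
      by_cases hω : i ∈ S (t + 1) ω
      · have h1 : ω ∈ E := hω
        rw [if_pos hω, Real.exp_add, ENNReal.ofReal_mul (Real.exp_nonneg _)]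
        simp [h1, Z, W, tiltedSum]
      · have h1 : ω ∉ E := hω
        rw [if_neg hω]
        simp [h1, Z, tiltedSum]
    simp_rw [hdec]
    have hW : Measurable[MeasurableSpace.comap (fun ω i => X (t + 1) i ω) inferInstance] W := by
      have : Measurable fun x : Fin n → ℝ =>
          ENNReal.ofReal (Real.exp (c * (x i - p i) - c ^ 2 / 8)) := by fun_prop
      exact this.comp (comap_measurable fun ω i => X (t + 1) i ω)
    have hXv : Measurable fun ω i => X (t + 1) i ω :=
      measurable_pi_lambda _ fun i => hX.measurable (t + 1) (by omega) i
    rw [lintegral_add_left ((hZ.mono hle le_rfl).indicator (hle _ hE).compl),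
      lintegral_mul_eq_lintegral_mul_lintegral_of_independent_measurableSpace hle hXv.comap_le
        (hind t) (hZ.indicator hE) hW]
    calc _ ≤ ∫⁻ ω, Eᶜ.indicator Z ω ∂μ + (∫⁻ ω, E.indicator Z ω ∂μ) * 1 := by
          gcongr
          exact hX.lintegral_exp_le_one (by omega) i c
      _ = ∫⁻ ω, Z ω ∂μ := by
          rw [mul_one, lintegral_indicator (hle _ hE).compl, lintegral_indicator (hle _ hE),
            add_comm, lintegral_add_compl _ (hle _ hE)]
      _ ≤ 1 := ih

theorem IsNonanticipating.measurable_tiltedSum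
    (h : IsNonanticipating μ X S) (q : ℝ) (i : Fin n) (c : ℝ) (t : ℕ) :
    Measurable (tiltedSum X S q i c t) := by
  obtain ⟨ℱ, hXm, hS, -⟩ := h
  exact (DemandResponse.measurable_tiltedSum hXm hS q i c t).mono (ℱ.le t) le_rfl

theorem measureReal_le_tiltedSum [IsProbabilityMeasure μ] (hX : IsResponseModel μ p X)
    (h : IsNonanticipating μ X S) (i : Fin n) (c : ℝ) (t : ℕ) (a : ℝ) :
    μ.real {ω | a ≤ tiltedSum X S (p i) i c t ω} ≤ Real.exp (-a) := by
  have hm := h.measurable_tiltedSum (p i) i c t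
  have h1 := mul_meas_ge_le_lintegral₀ (μ := μ)
    (f := fun ω => ENNReal.ofReal (Real.exp (tiltedSum X S (p i) i c t ω)))
    hm.exp.ennreal_ofReal.aemeasurable (ENNReal.ofReal (Real.exp a))
  have h2 := h1.trans (lintegral_exp_tiltedSum_le_one hX h i c t)
  simp only [ENNReal.ofReal_le_ofReal_iff (Real.exp_nonneg _), Real.exp_le_exp] at h2
  have h3 := ENNReal.toReal_mono (by simp) h2
  rw [ENNReal.toReal_mul, ENNReal.toReal_ofReal (Real.exp_nonneg _), ENNReal.toReal_one] at h3
  rw [Real.exp_neg, ← one_div, le_div_iff₀' (Real.exp_pos a)]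
  exact h3

/-- Off an event of small probability, the sample average of an arm that has been selected at least
once lies within the confidence radius of its mean. -/
theorem exists_confidence_event [IsProbabilityMeasure μ]
    (hX : IsResponseModel μ p X) (h : IsNonanticipating μ X S)
    (i : Fin n) {α : ℝ} (hα : 0 ≤ α) (t : ℕ) (ht : 1 ≤ t) :
    ∃ E : Set Ω, MeasurableSet E ∧ μ.real E ≤ 2 * (t : ℝ) ^ (1 - α) ∧
      ∀ ω ∉ E, 1 ≤ pullCount S (t - 1) i ω →
        |sampleAvg X S (t - 1) i ω - p i| ≤
          √(α * Real.log t / (2 * pullCount S (t - 1) i ω)) := by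
  have ht' : (1 : ℝ) ≤ t := by exact_mod_cast ht
  have hlog : 0 ≤ α * Real.log t := mul_nonneg hα (Real.log_nonneg ht')
  set r : ℕ → ℝ := fun s => √(α * Real.log t / (2 * s)) with hr
  set F : ℝ → Set Ω := fun c => {ω | α * Real.log t ≤ tiltedSum X S (p i) i c (t - 1) ω}
  -- The pull count is random but `c` must be fixed, hence a union over its values `s`. The choice
  -- `c = 4 * r s` maximizes `c * r s - c ^ 2 / 8`, and `s * (2 * r s ^ 2) = α * log t`; the two
  -- signs cover the two tails.
  refine ⟨⋃ s ∈ Finset.Icc 1 (t - 1), (F (4 * r s) ∪ F (-(4 * r s))), ?_, ?_, ?_⟩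
  · have hF : ∀ c, MeasurableSet (F c) := fun c =>
      measurableSet_le measurable_const (h.measurable_tiltedSum (p i) i c (t - 1))
    exact Finset.measurableSet_biUnion _ fun s _ => (hF _).union (hF _)
  · have hF : ∀ c, μ.real (F c) ≤ (t : ℝ) ^ (-α) := fun c => by
      refine (measureReal_le_tiltedSum hX h i c (t - 1) _).trans_eq ?_
      rw [Real.rpow_def_of_pos (by linarith)]
      ring_nf
    calc _ ≤ ∑ s ∈ Finset.Icc 1 (t - 1), μ.real (F (4 * r s) ∪ F (-(4 * r s))) :=
          measureReal_biUnion_finset_le _ _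
      _ ≤ ∑ s ∈ Finset.Icc 1 (t - 1), ((t : ℝ) ^ (-α) + (t : ℝ) ^ (-α)) :=
          Finset.sum_le_sum fun s _ => (measureReal_union_le _ _).trans (add_le_add (hF _) (hF _))
      _ = ((t - 1 : ℕ) : ℝ) * (2 * (t : ℝ) ^ (-α)) := by
          rw [Finset.sum_const, Nat.card_Icc, nsmul_eq_mul]
          simp only [Nat.add_sub_cancel]
          ring
      _ ≤ (t : ℝ) * (2 * (t : ℝ) ^ (-α)) := by
          gcongr
          omega
      _ = 2 * (t : ℝ) ^ (1 - α) := by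
          rw [sub_eq_add_neg, Real.rpow_add (by linarith), Real.rpow_one]
          ring
  · intro ω hω hT
    by_contra! hlt
    apply hω
    have hTle : pullCount S (t - 1) i ω ≤ t - 1 := by
      refine (Finset.card_filter_le _ _).trans ?_
      simp
    simp only [Set.mem_iUnion]
    refine ⟨pullCount S (t - 1) i ω, Finset.mem_Icc.2 ⟨hT, hTle⟩, ?_⟩
    have hT0 : (0 : ℝ) < pullCount S (t - 1) i ω := by exact_mod_cast hT
    change r (pullCount S (t - 1) i ω) < _ at hlt
    have hr0 : 0 ≤ r (pullCount S (t - 1) i ω) := Real.sqrt_nonneg _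
    have hsq : r (pullCount S (t - 1) i ω) ^ 2 =
        α * Real.log t / (2 * pullCount S (t - 1) i ω) :=
      Real.sq_sqrt (by positivity)
    rw [eq_div_iff (by positivity)] at hsq
    set ρ := r (pullCount S (t - 1) i ω)
    rcases lt_abs.1 hlt with hl | hl
    · left
      change α * Real.log t ≤ tiltedSum X S (p i) i _ (t - 1) ω
      rw [tiltedSum_eq X S _ i _ (t - 1) ω hT, ← hsq]
      have : ρ * ρ ≤ ρ * (sampleAvg X S (t - 1) i ω - p i) := by gcongr
      nlinarith
    · right
      change α * Real.log t ≤ tiltedSum X S (p i) i _ (t - 1) ω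
      rw [tiltedSum_eq X S _ i _ (t - 1) ω hT, ← hsq]
      have : ρ * ρ ≤ ρ * -(sampleAvg X S (t - 1) i ω - p i) := by gcongr
      nlinarith

end Model

/-- Comparison with the integral of `x ^ (1 - α)` from `1`. With `1 ≤ m` the sum starts at `2` or
later, so the term at `1` adds nothing. -/
theorem sum_rpow_le {α : ℝ} (hα : 2 < α) {m : ℕ} (hm : 1 ≤ m) (T : ℕ) :
    ∑ t ∈ Finset.Ioc m T, (t : ℝ) ^ (1 - α) ≤ 1 / (α - 2) := by
  have hα' : 0 < α - 2 := by linarith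
  rcases Nat.eq_zero_or_pos T with rfl | hT
  · simpa using hα'.le
  have h1 : ∑ t ∈ Finset.Ioc m T, (t : ℝ) ^ (1 - α) ≤
      ∑ t ∈ Finset.Ico 1 T, ((t + 1 : ℕ) : ℝ) ^ (1 - α) := by
    rw [Finset.sum_Ico_add' (fun t : ℕ => (t : ℝ) ^ (1 - α)) 1 T 1]
    exact Finset.sum_le_sum_of_subset_of_nonneg
      (fun t ht => by simp only [Finset.mem_Ioc, Finset.mem_Ico] at *; omega)
      fun t _ _ => by positivity
  refine h1.trans ?_
  have hanti : AntitoneOn (fun x : ℝ => x ^ (1 - α)) (Set.Icc ((1 : ℕ) : ℝ) T) := by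
    intro x hx y hy hxy
    have : (0 : ℝ) < x := lt_of_lt_of_le (by simp) hx.1
    exact Real.rpow_le_rpow_of_nonpos this hxy (by linarith)
  refine (hanti.sum_le_integral_Ico hT).trans ?_
  rw [Nat.cast_one, integral_rpow (Or.inr ⟨by linarith, ?_⟩)]
  · have h2 : 0 ≤ (T : ℝ) ^ (1 - α + 1) := by positivity
    rw [Real.one_rpow, ← neg_div_neg_eq, neg_sub, show -(1 - α + 1) = α - 2 by ring]
    gcongr
    linarith
  · rw [Set.uIcc_of_le (by exact_mod_cast hT)]
    simp

/-! ### Counting costly steps along a sample path. -/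

section Selection

variable {Ω : Type*} {n : ℕ} {X : ℕ → Fin n → Ω → ℝ} {S : ℕ → Ω → Finset (Fin n)} {ω : Ω}

theorem pullCount_pos {i : Fin n} {t τ : ℕ} (hτ : τ ∈ Finset.Icc 1 t) (hi : i ∈ S τ ω) :
    1 ≤ pullCount S t i ω :=
  Finset.card_pos.2 ⟨τ, Finset.mem_filter.2 ⟨hτ, hi⟩⟩

theorem pullCount_lt_pullCount {i : Fin n} {t u : ℕ} (ht : 1 ≤ t) (htu : t < u)
    (hi : i ∈ S t ω) : pullCount S (t - 1) i ω < pullCount S (u - 1) i ω := by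
  refine Finset.card_lt_card (Finset.ssubset_iff_subset_ne.2 ⟨fun τ hτ => ?_, fun h => ?_⟩)
  · simp only [Finset.mem_filter, Finset.mem_Icc] at hτ ⊢
    exact ⟨⟨hτ.1.1, by omega⟩, hτ.2⟩
  · have hmem : t ∈ (Finset.Icc 1 (u - 1)).filter fun τ => i ∈ S τ ω :=
      Finset.mem_filter.2 ⟨Finset.mem_Icc.2 ⟨ht, by omega⟩, hi⟩
    rw [← h, Finset.mem_filter, Finset.mem_Icc] at hmem
    omega

/-- An arm is selected at most `ℓ` times while its selection count is positive and at most `ℓ`. -/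
theorem card_filter_pullCount_le (i : Fin n) (I : Finset ℕ) {ℓ : ℝ} (hℓ : 0 ≤ ℓ)
    (hI : ∀ t ∈ I, 1 ≤ t ∧ 1 ≤ pullCount S (t - 1) i ω) :
    ((I.filter fun t => i ∈ S t ω ∧ (pullCount S (t - 1) i ω : ℝ) ≤ ℓ).card : ℝ) ≤ ℓ := by
  refine le_trans ?_ (Nat.floor_le hℓ)
  -- The count grows strictly with each pull, so it is injective on these times. Excluding the value
  -- zero gives `ℓ` instead of `ℓ + 1`.
  have h := Finset.card_le_card_of_injOn (t := Finset.Icc 1 ⌊ℓ⌋₊)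
    (s := I.filter fun t => i ∈ S t ω ∧ (pullCount S (t - 1) i ω : ℝ) ≤ ℓ)
    (fun t => pullCount S (t - 1) i ω) (fun t ht => by
      have ht' := Finset.mem_filter.1 (Finset.mem_coe.1 ht)
      exact Finset.mem_coe.2 (Finset.mem_Icc.2 ⟨(hI t ht'.1).2, Nat.le_floor ht'.2.2⟩))
    (fun t ht u hu htu => by
      have ht' := Finset.mem_filter.1 (Finset.mem_coe.1 ht)
      have hu' := Finset.mem_filter.1 (Finset.mem_coe.1 hu)
      simp only at htu
      by_contra hne
      rcases Nat.lt_or_gt_of_ne hne with hlt | hlt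
      · exact (pullCount_lt_pullCount (hI t ht'.1).1 hlt ht'.2.1).ne htu
      · exact (pullCount_lt_pullCount (hI u hu'.1).1 hlt hu'.2.1).ne htu.symm)
  rw [Nat.card_Icc, Nat.add_sub_cancel] at h
  exact_mod_cast h

theorem IsCUCBAvg.one_le_pullCount {α D : ℝ} (hC : IsCUCBAvg α D X S) {t : ℕ}
    (ht : initLength n D < t) (i : Fin n) : 1 ≤ pullCount S (t - 1) i ω := by
  obtain ⟨τ, hτ, hi⟩ := hC.init ω i
  rw [Finset.mem_Icc] at hτ
  exact pullCount_pos (Finset.mem_Icc.2 ⟨hτ.1, by omega⟩) hi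

/-- The selection is optimal once all estimates are within their confidence radii and the selected
arms have small radii. -/
theorem IsCUCBAvg.expectedLoss_le {α D ε : ℝ} (hC : IsCUCBAvg α D X S) {p : Fin n → unitInterval}
    (hε : 0 < ε) (hgap : ∀ i j, (p i : ℝ) < p j → (p i : ℝ) + 2 * ε < p j)
    (hlow : ∀ A : Finset (Fin n), ∑ i ∈ A, (p i : ℝ) < D - 1 / 2 →
      ∑ i ∈ A, (p i : ℝ) + n * ε < D - 1 / 2)
    (hhigh : ∀ A : Finset (Fin n), D - 1 / 2 < ∑ i ∈ A, (p i : ℝ) →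
      D - 1 / 2 < ∑ i ∈ A, (p i : ℝ) - n * ε)
    {t : ℕ} (ht : initLength n D < t)
    (hconf : ∀ i, |sampleAvg X S (t - 1) i ω - p i| ≤
      √(α * Real.log t / (2 * pullCount S (t - 1) i ω)))
    (hrad : ∀ i ∈ S t ω, √(α * Real.log t / (2 * pullCount S (t - 1) i ω)) ≤ ε)
    (B : Finset (Fin n)) :
    expectedLoss (fun i => (p i : ℝ)) D (S t ω) ≤ expectedLoss (fun i => (p i : ℝ)) D B := by
  obtain ⟨σ, hσ, hS⟩ := hC.select ω t ht
  rw [hS] at hrad ⊢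
  exact expectedLoss_topArms_le (fun i => (p i : ℝ)) (fun i => (p i).2.1) (fun i => (p i).2.2) D ε
    hε hgap hlow hhigh _ _ hconf σ hσ hrad B

/-- Fixes the number of pulls after which an arm's radius is at most `ε` throughout the horizon `T`.
-/
theorem sqrt_radius_le {α ε : ℝ} (hα : 0 ≤ α) (hε : 0 < ε) {t T : ℕ} (ht : 1 ≤ t) (htT : t ≤ T)
    {k : ℝ} (hk : α * Real.log T / (2 * ε ^ 2) < k) : √(α * Real.log t / (2 * k)) ≤ ε := by
  have ht' : (1 : ℝ) ≤ t := by exact_mod_cast ht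
  have hlog : Real.log t ≤ Real.log T := Real.log_le_log (by linarith) (by exact_mod_cast htT)
  have hlog0 : 0 ≤ Real.log t := Real.log_nonneg ht'
  have hk0 : 0 < k := lt_of_le_of_lt (by positivity) hk
  rw [div_lt_iff₀ (by positivity)] at hk
  rw [Real.sqrt_le_left hε.le, div_le_iff₀ (by positivity)]
  nlinarith [mul_le_mul_of_nonneg_left hlog hα]

/-- The regret along a sample path, up to the confidence events `E i t`. -/
theorem IsCUCBAvg.sum_expectedLoss_sub_le {α D ε M : ℝ} (hC : IsCUCBAvg α D X S)
    {p : Fin n → unitInterval} (hα : 0 ≤ α)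
    (hε : 0 < ε) (hgap : ∀ i j, (p i : ℝ) < p j → (p i : ℝ) + 2 * ε < p j)
    (hlow : ∀ A : Finset (Fin n), ∑ i ∈ A, (p i : ℝ) < D - 1 / 2 →
      ∑ i ∈ A, (p i : ℝ) + n * ε < D - 1 / 2)
    (hhigh : ∀ A : Finset (Fin n), D - 1 / 2 < ∑ i ∈ A, (p i : ℝ) →
      D - 1 / 2 < ∑ i ∈ A, (p i : ℝ) - n * ε)
    (hM : ∀ A : Finset (Fin n), expectedLoss (fun i => (p i : ℝ)) D A ≤ M)
    (Sstar : ℕ → Finset (Fin n)) (T : ℕ) (E : Fin n → ℕ → Set Ω)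
    (hE : ∀ i t, 1 ≤ t → ω ∉ E i t → 1 ≤ pullCount S (t - 1) i ω →
      |sampleAvg X S (t - 1) i ω - p i| ≤
        √(α * Real.log t / (2 * pullCount S (t - 1) i ω))) :
    ∑ t ∈ Finset.Icc 1 T, (expectedLoss (fun i => (p i : ℝ)) D (S t ω) -
        expectedLoss (fun i => (p i : ℝ)) D (Sstar t)) ≤
      M * (initLength n D + n * (α * Real.log T / (2 * ε ^ 2))) +
        M * ∑ t ∈ Finset.Ioc (initLength n D) T, ∑ i, (E i t).indicator 1 ω := by
  have hM0 : 0 ≤ M := (expectedLoss_nonneg p D ∅).trans (hM ∅)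
  have hlogT : 0 ≤ Real.log T := Real.log_natCast_nonneg T
  set ℓ := α * Real.log T / (2 * ε ^ 2) with hℓ
  have hℓ0 : 0 ≤ ℓ := by positivity
  let e : ℕ → ℝ := fun t => ∑ i, (E i t).indicator 1 ω
  let b : ℕ → ℝ := fun t =>
    ∑ i, if i ∈ S t ω ∧ (pullCount S (t - 1) i ω : ℝ) ≤ ℓ then 1 else 0
  have he0 : ∀ i t, 0 ≤ (E i t).indicator (1 : Ω → ℝ) ω := fun i t =>
    Set.indicator_nonneg (fun _ _ => zero_le_one) _
  have hb0 : ∀ t, 0 ≤ b t := fun t => Finset.sum_nonneg fun i _ => by split_ifs <;> simp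
  -- A step is charged `M` for initialization, for a failed confidence interval (`e`), or for a
  -- selected arm with few pulls (`b`). Failing all three, the selection is optimal.
  have hterm : ∀ t ∈ Finset.Icc 1 T, expectedLoss (fun i => (p i : ℝ)) D (S t ω) -
      expectedLoss (fun i => (p i : ℝ)) D (Sstar t) ≤
      M * ((if t ≤ initLength n D then 1 else 0) +
        if initLength n D < t then b t + e t else 0) := by
    intro t ht
    rw [Finset.mem_Icc] at ht
    have hΔ : expectedLoss (fun i => (p i : ℝ)) D (S t ω) -
        expectedLoss (fun i => (p i : ℝ)) D (Sstar t) ≤ M := by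
      linarith [hM (S t ω), expectedLoss_nonneg p D (Sstar t)]
    by_cases hinit : t ≤ initLength n D
    · rw [if_pos hinit, if_neg (by omega)]
      linarith
    rw [if_neg hinit, if_pos (by omega), zero_add]
    have hge : ∀ x : ℝ, 1 ≤ x → expectedLoss (fun i => (p i : ℝ)) D (S t ω) -
        expectedLoss (fun i => (p i : ℝ)) D (Sstar t) ≤ M * x := fun x hx =>
      hΔ.trans (le_mul_of_one_le_right hM0 hx)
    have het : 0 ≤ e t := Finset.sum_nonneg fun i _ => he0 i t
    by_cases hbad : ∃ i, ω ∈ E i t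
    · obtain ⟨i, hi⟩ := hbad
      apply hge
      have h1 : (E i t).indicator (1 : Ω → ℝ) ω ≤ e t :=
        Finset.single_le_sum (f := fun i => (E i t).indicator (1 : Ω → ℝ) ω)
          (fun i _ => he0 i t) (Finset.mem_univ i)
      rw [Set.indicator_of_mem hi, Pi.one_apply] at h1
      linarith [hb0 t]
    by_cases hfew : ∃ i, i ∈ S t ω ∧ (pullCount S (t - 1) i ω : ℝ) ≤ ℓ
    · obtain ⟨i, hi⟩ := hfew
      apply hge
      have h1 : (if i ∈ S t ω ∧ (pullCount S (t - 1) i ω : ℝ) ≤ ℓ then (1 : ℝ) else 0) ≤ b t :=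
        Finset.single_le_sum
          (f := fun i => if i ∈ S t ω ∧ (pullCount S (t - 1) i ω : ℝ) ≤ ℓ then (1 : ℝ) else 0)
          (fun i _ => by split_ifs <;> simp) (Finset.mem_univ i)
      rw [if_pos hi] at h1
      linarith
    push Not at hbad hfew
    have hopt := hC.expectedLoss_le (ω := ω) hε hgap hlow hhigh (not_le.1 hinit)
      (fun i => hE i t ht.1 (hbad i) (hC.one_le_pullCount (not_le.1 hinit) i))
      (fun i hi => sqrt_radius_le hα hε ht.1 ht.2 (hfew i hi)) (Sstar t)
    have : 0 ≤ M * (b t + e t) := mul_nonneg hM0 (add_nonneg (hb0 t) het)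
    linarith
  refine (Finset.sum_le_sum hterm).trans ?_
  rw [← Finset.mul_sum, ← mul_add, Finset.sum_add_distrib]
  refine mul_le_mul_of_nonneg_left ?_ hM0
  have hIoc : (Finset.Icc 1 T).filter (fun t => initLength n D < t) =
      Finset.Ioc (initLength n D) T := by
    ext t
    simp only [Finset.mem_filter, Finset.mem_Icc, Finset.mem_Ioc]
    omega
  have h1 : ∑ t ∈ Finset.Icc 1 T, (if t ≤ initLength n D then (1 : ℝ) else 0) ≤
      initLength n D := by
    rw [Finset.sum_boole]
    have : ((Finset.Icc 1 T).filter fun t => t ≤ initLength n D).card ≤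
        (Finset.Icc 1 (initLength n D)).card := Finset.card_le_card fun t ht => by
      simp only [Finset.mem_filter, Finset.mem_Icc] at ht ⊢
      omega
    rw [Nat.card_Icc, Nat.add_sub_cancel] at this
    exact_mod_cast this
  have h2 : ∑ t ∈ Finset.Ioc (initLength n D) T, b t ≤ n * ℓ := by
    rw [Finset.sum_comm]
    refine (Finset.sum_le_card_nsmul Finset.univ _ ℓ fun i _ => ?_).trans_eq (by simp)
    rw [Finset.sum_boole]
    refine card_filter_pullCount_le i _ hℓ0 fun t ht => ?_
    rw [Finset.mem_Ioc] at ht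
    exact ⟨by omega, hC.one_le_pullCount ht.1 i⟩
  rw [← Finset.sum_filter (fun t => initLength n D < t), hIoc, Finset.sum_add_distrib]
  linarith

end Selection

/-! ### Expected regret and its logarithmic growth. -/

section Regret

variable {Ω : Type*} [MeasurableSpace Ω] {μ : Measure Ω} [IsProbabilityMeasure μ] {n : ℕ}
  {p : Fin n → unitInterval} {X : ℕ → Fin n → Ω → ℝ} {S : ℕ → Ω → Finset (Fin n)}

theorem integrable_cumulativeRegret_and_regret_eq (hX : IsResponseModel μ p X)
    (h : IsNonanticipating μ X S) (D : ℝ) (Sstar : ℕ → Finset (Fin n)) (T : ℕ) :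
    Integrable (cumulativeRegret X S D Sstar T) μ ∧
      regret μ X S D Sstar T =
        ∫ ω, ∑ t ∈ Finset.Icc 1 T, (expectedLoss (fun i => (p i : ℝ)) D (S t ω) -
          expectedLoss (fun i => (p i : ℝ)) D (Sstar t)) ∂μ := by
  have hint : ∀ t ∈ Finset.Icc 1 T,
      Integrable (fun ω => loss X D t (S t ω) ω - loss X D t (Sstar t) ω) μ := fun t ht =>
    have ht := (Finset.mem_Icc.1 ht).1
    (integrable_loss_selection_and_integral_eq hX h ht D).1.sub (hX.integrable_loss ht D _)
  refine ⟨integrable_finsetSum _ hint, ?_⟩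
  have hint' : ∀ t ∈ Finset.Icc 1 T,
      Integrable (fun ω => expectedLoss (fun i => (p i : ℝ)) D (S t ω)) μ := fun t ht =>
    integrable_comp_selection (h.measurable (Finset.mem_Icc.1 ht).1) _
  have hdiff : ∀ t ∈ Finset.Icc 1 T, Integrable (fun ω =>
      expectedLoss (fun i => (p i : ℝ)) D (S t ω) -
        expectedLoss (fun i => (p i : ℝ)) D (Sstar t)) μ := fun t ht =>
    (hint' t ht).sub (integrable_const _)
  unfold regret cumulativeRegret
  rw [integral_finsetSum _ hint, integral_finsetSum _ hdiff]
  refine Finset.sum_congr rfl fun t ht => ?_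
  have ht1 := (Finset.mem_Icc.1 ht).1
  have hsel := integrable_loss_selection_and_integral_eq hX h ht1 D
  rw [integral_sub hsel.1 (hX.integrable_loss ht1 D _), hsel.2, hX.integral_loss ht1,
    integral_sub (hint' t ht) (integrable_const _)]
  simp

theorem IsOptimal.expectedLoss_le (hX : IsResponseModel μ p X) {D : ℝ} {t : ℕ} (ht : 1 ≤ t)
    {A : Finset (Fin n)} (hA : IsOptimal μ X D t A) (B : Finset (Fin n)) :
    expectedLoss (fun i => (p i : ℝ)) D A ≤ expectedLoss (fun i => (p i : ℝ)) D B := by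
  have := hA B
  rwa [hX.integral_loss ht, hX.integral_loss ht] at this

/-- The `O`-statement bounds the absolute value, so the upper bound alone does not suffice. -/
theorem regret_nonneg (hX : IsResponseModel μ p X) (h : IsNonanticipating μ X S) {D : ℝ}
    {Sstar : ℕ → Finset (Fin n)} (hopt : ∀ t, 1 ≤ t → IsOptimal μ X D t (Sstar t)) (T : ℕ) :
    0 ≤ regret μ X S D Sstar T := by
  rw [(integrable_cumulativeRegret_and_regret_eq hX h D Sstar T).2]
  refine integral_nonneg fun ω => Finset.sum_nonneg fun t ht => ?_
  have ht1 := (Finset.mem_Icc.1 ht).1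
  exact sub_nonneg.2 ((hopt t ht1).expectedLoss_le hX ht1 _)

theorem one_le_initLength {D : ℝ} (hD : 0 < D) (hn : 1 ≤ n) : 1 ≤ initLength n D := by
  rw [initLength, Nat.one_le_ceil_iff]
  have : 0 < ⌈2 * D⌉₊ := Nat.ceil_pos.2 (by linarith)
  positivity

theorem regret_le {α D ε : ℝ} (hD : 0 < D) (hα : 2 < α) (hX : IsResponseModel μ p X)
    (h : IsNonanticipating μ X S) (hC : IsCUCBAvg α D X S)
    (hε : 0 < ε) (hgap : ∀ i j, (p i : ℝ) < p j → (p i : ℝ) + 2 * ε < p j)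
    (hlow : ∀ A : Finset (Fin n), ∑ i ∈ A, (p i : ℝ) < D - 1 / 2 →
      ∑ i ∈ A, (p i : ℝ) + n * ε < D - 1 / 2)
    (hhigh : ∀ A : Finset (Fin n), D - 1 / 2 < ∑ i ∈ A, (p i : ℝ) →
      D - 1 / 2 < ∑ i ∈ A, (p i : ℝ) - n * ε)
    (Sstar : ℕ → Finset (Fin n)) (T : ℕ) :
    regret μ X S D Sstar T ≤
      max (D ^ 2) ((n - D) ^ 2) * ((initLength n D : ℝ) + 2 * n / (α - 2)) +
        α * max (D ^ 2) ((n - D) ^ 2) * n * Real.log T / (2 * ε ^ 2) := by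
  set M := max (D ^ 2) (((n : ℝ) - D) ^ 2)
  have hM0 : 0 ≤ M := (sq_nonneg D).trans (le_max_left _ _)
  have hα0 : 0 ≤ α := by linarith
  have hev : ∀ (i : Fin n) (t : ℕ), ∃ E : Set Ω, MeasurableSet E ∧
      (1 ≤ t → μ.real E ≤ 2 * (t : ℝ) ^ (1 - α) ∧ ∀ ω ∉ E, 1 ≤ pullCount S (t - 1) i ω → |sampleAvg X S (t - 1) i ω - p i| ≤
        √(α * Real.log t / (2 * pullCount S (t - 1) i ω))) := by
    intro i t
    by_cases ht : 1 ≤ t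
    · obtain ⟨E, hEm, hE⟩ := exists_confidence_event hX h i hα0 t ht
      exact ⟨E, hEm, fun _ => hE⟩
    · exact ⟨∅, MeasurableSet.empty, fun ht' => absurd ht' ht⟩
  choose E hEm hE using hev
  have hind : ∀ i t, Integrable ((E i t).indicator (1 : Ω → ℝ)) μ := fun i t =>
    (integrable_const (1 : ℝ)).indicator (hEm i t)
  have hsumi : Integrable (fun ω => ∑ t ∈ Finset.Ioc (initLength n D) T,
      ∑ i, (E i t).indicator (1 : Ω → ℝ) ω) μ :=
    integrable_finsetSum _ fun t _ => integrable_finsetSum _ fun i _ => hind i t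
  have hprob : ∫ ω, ∑ t ∈ Finset.Ioc (initLength n D) T,
      ∑ i, (E i t).indicator (1 : Ω → ℝ) ω ∂μ ≤ 2 * n / (α - 2) := by
    rw [integral_finsetSum _ fun t _ => integrable_finsetSum _ fun i _ => hind i t]
    calc _ ≤ ∑ t ∈ Finset.Ioc (initLength n D) T, 2 * n * (t : ℝ) ^ (1 - α) := by
          refine Finset.sum_le_sum fun t ht => ?_
          rw [integral_finsetSum _ fun i _ => hind i t]
          have ht1 : 1 ≤ t := by
            rw [Finset.mem_Ioc] at ht
            omega
          refine (Finset.sum_le_card_nsmul Finset.univ _ (2 * (t : ℝ) ^ (1 - α))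
            fun i _ => ?_).trans_eq ?_
          · rw [integral_indicator_one (hEm i t)]
            exact (hE i t ht1).1
          · simp only [Finset.card_univ, Fintype.card_fin, nsmul_eq_mul]
            ring
      _ = 2 * n * ∑ t ∈ Finset.Ioc (initLength n D) T, (t : ℝ) ^ (1 - α) := by
          rw [Finset.mul_sum]
      _ ≤ 2 * n / (α - 2) := by
          -- Without arms the initialization has length zero and `sum_rpow_le` does not apply, but
          -- both sides vanish.
          rcases Nat.eq_zero_or_pos n with rfl | hn
          · simp
          · rw [← mul_one_div]
            gcongr
            exact sum_rpow_le hα (one_le_initLength hD hn) T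
  rw [(integrable_cumulativeRegret_and_regret_eq hX h D Sstar T).2]
  have hselm : ∀ t ∈ Finset.Icc 1 T, Integrable (fun ω =>
      expectedLoss (fun i => (p i : ℝ)) D (S t ω) -
        expectedLoss (fun i => (p i : ℝ)) D (Sstar t)) μ := fun t ht =>
    (integrable_comp_selection (h.measurable (Finset.mem_Icc.1 ht).1) _).sub (integrable_const _)
  refine (integral_mono (integrable_finsetSum _ hselm)
    ((integrable_const _).add (hsumi.const_mul M)) fun ω =>
      hC.sum_expectedLoss_sub_le (M := M) hα0 hε hgap hlow hhigh (hX.expectedLoss_le D) Sstar T E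
        fun i t ht => (hE i t ht).2 ω).trans ?_
  rw [integral_add' (integrable_const _) (hsumi.const_mul M)]
  simp only [integral_const, probReal_univ, one_smul]
  rw [integral_const_mul]
  have := mul_le_mul_of_nonneg_left hprob hM0
  calc _ ≤ M * (initLength n D + n * (α * Real.log T / (2 * ε ^ 2))) +
        M * (2 * n / (α - 2)) := by linarith
    _ = _ := by ring

end Regret

theorem isBigO_log_of_le {f : ℕ → ℝ} (hf : ∀ T, 0 ≤ f T) {a b : ℝ} (ha : 0 ≤ a)
    (hle : ∀ T : ℕ, f T ≤ a + b * Real.log T) :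
    f =O[Filter.atTop] fun T : ℕ => Real.log T := by
  refine Asymptotics.IsBigO.of_bound (a + b) ?_
  -- From `3 > e` on, `log T ≥ 1` absorbs the constant `a`.
  filter_upwards [Filter.eventually_ge_atTop 3] with T hT
  have h1 : 1 ≤ Real.log T := by
    rw [Real.le_log_iff_exp_le (by positivity)]
    have : (3 : ℝ) ≤ T := by exact_mod_cast hT
    linarith [Real.exp_one_lt_d9]
  rw [Real.norm_of_nonneg (hf T), Real.norm_of_nonneg (by linarith)]
  nlinarith [hle T]

end DemandResponse

theorem theorem2 {n : ℕ} (p : Fin n → unitInterval) (D : ℝ) (hD : 0 < D) :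
    ∃ ε₀ : ℝ, 0 < ε₀ ∧
      ∀ (α : ℝ), 2 < α →
      ∀ (Ω : Type*) [MeasurableSpace Ω] (μ : Measure Ω) [IsProbabilityMeasure μ]
        (X : ℕ → Fin n → Ω → ℝ) (S : ℕ → Ω → Finset (Fin n)) (Sstar : ℕ → Finset (Fin n)),
        DemandResponse.IsResponseModel μ p X →
        DemandResponse.IsNonanticipating μ X S →
        DemandResponse.IsCUCBAvg α D X S →
        (∀ t, 1 ≤ t → DemandResponse.IsOptimal μ X D t (Sstar t)) →
        (∀ T : ℕ,
          Integrable (DemandResponse.cumulativeRegret X S D Sstar T) μ ∧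
          DemandResponse.regret μ X S D Sstar T ≤
            max (D ^ 2) ((n - D) ^ 2) *
                ((⌈(n : ℝ) / (⌈2 * D⌉₊ : ℝ)⌉₊ : ℝ) + 2 * n / (α - 2)) +
              α * max (D ^ 2) ((n - D) ^ 2) * n * Real.log T / (2 * ε₀ ^ 2)) ∧
        (fun T : ℕ => DemandResponse.regret μ X S D Sstar T) =O[Filter.atTop]
          (fun T : ℕ => Real.log T) := by
  obtain ⟨ε, hε, hgap, hlow, hhigh⟩ :=
    DemandResponse.exists_accuracy (fun i => (p i : ℝ)) D
  refine ⟨ε, hε, fun α hα Ω _ μ _ X S Sstar hX hN hC hopt => ?_⟩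
  have hle := DemandResponse.regret_le hD hα hX hN hC hε hgap hlow hhigh Sstar
  refine ⟨fun T => ⟨?_, hle T⟩, ?_⟩
  · exact (DemandResponse.integrable_cumulativeRegret_and_regret_eq hX hN D Sstar T).1
  · have hα' : 0 < α - 2 := by linarith
    refine DemandResponse.isBigO_log_of_le (DemandResponse.regret_nonneg hX hN hopt)
      (a := max (D ^ 2) ((n - D) ^ 2) *
        ((DemandResponse.initLength n D : ℝ) + 2 * n / (α - 2)))
      (b := α * max (D ^ 2) ((n - D) ^ 2) * n / (2 * ε ^ 2)) (by positivity)
      fun T => (hle T).trans_eq (by ring)
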